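/- Graphs are finite, simple and undirected; $d(u,v)\in\mathbb N\cup\{\infty\}$ is the number of edges of a shortest path between $u$ and $v$. Write $[t]=\{1,\dots,t\}$ and $\mathrm{len}(t)=1+\lfloor\log_2 t\rfloor$ for $t\ge 1$, and $N(v)$ for the set of neighbours of $v$. **Identifying functions.** An identifying function $f$ assigns to every graph $G$ and all vertices $w$ and $u\ne v$ of $G$ a truth value $f_G[w](u,v)=f_G[w](v,u)$. It is a *distance* identifying function if $f_G[w](u,v)$ is false whenever $d(u,w)=d(v,w)$. It is *$i$-layered* if $f_G[w](u,v)$ is true whenever $\min\{d(u,w),d(v,w)\}\le i$ and $d(u,w)\neq d(v,w)$. It is *$i$-local* if $f_G[w](u,v)$ is true whenever exactly one of $d(u,w),d(v,w)$ is at most $i$, and false whenever both are larger than $i$. A vertex set $C$ *$f$-distinguishes* vertex sets $X$ and $Y$ of $G$ if for all $x\in X$ and $y\in Y$ with $x\ne y$ some $w\in C$ makes $f_G[w](x,y)$ true. For $r\in\{1,2,\dots\}\cup\{\infty\}$, a set $D$ of vertices is *$r$-dominating* if every vertex is at finite distance at most $r$ from some vertex of $D$. An *$(f,r)$-distance identifying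 set* of $G=(V,E)$ is an $r$-dominating set of $G$ that $f$-distinguishes $V$ and $V$. **Gadgets.** Let $H$ be a connected graph and $B\subseteq V_H$. A *$B$-extension* of $H$ is a connected graph $G$ that contains $H$ (more precisely, a copy of $H$) as an induced subgraph and is such that $N(v)\cap V_H\in\{\emptyset,B\}$ for every $v\in V_G\setminus V_H$. Those $v\in V_G\setminus V_H$ with $N(v)\cap V_H=B$ are called *$B$-adjacent* and form the set $N_B$. For $C\subseteq V_H$, the triple $(H,B,C)$ is an *$(f,r)$-gadget* if for every $B$-extension $G$ of $H$: (i) $C$ $f$-distinguishes $V_H$ and $V_G$; (ii) $C$ $f$-distinguishes $N_B$ and $(V_G\setminus V_H)\setminus N_B$; (iii) $C$ is an $r$-dominating set of $G[V_H\cup N_B]$; (iv) $|C|\le|S\cap V_H|$ for every $(f,r)$-distance identifying set $S$ of $G$. An $(f,r)$-gadget is *local* if $r\neq\infty$, $f$ is $r$-local, and for every $k\in[r]$ there is $c\in C$ with $d(c,B)=k-1$, where $d(c,B)=\min_{b\in B}d(c,b)$. **Compressed graph.** An instance $(\Omega,\mathcal S)$ of Hitting Set consists of $\Omega=\{u_1,\dots,u_n\}$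 and $\mathcal S=\{S_1,\dots,S_m\}$, where the $S_j$ are non-empty subsets of $\Omega$ with union $\Omega$. A hitting set is a subset of $\Omega$ that meets every $S_j$. For a connected graph $H$, $B\subseteq V_H$ and an integer $r\ge1$, the graph $\Psi[H,B,r](\Omega,\mathcal S)$ consists of disjoint copies $H^\Omega_t$ ($t\in[\mathrm{len}(n+1)]$) and $H^{\mathcal S}_t$ ($t\in[\mathrm{len}(m)]$) of $H$, with copies $B^\Omega_t$, $B^{\mathcal S}_t$ of $B$, together with the following vertices and edges: * for each $j\in[m]$, two vertices $v_j$ and $\bar v_j$, both joined to all vertices of $B^{\mathcal S}_t$ for each $t$ such that the $t$-th binary digit of $j$ is $1$; * for each $i\in[n]$, a path $l_i^0,l_i^1,\dots,l_i^{r-1}$, where $l_i^0$ is joined to all vertices of $B^\Omega_t$ for each $t$ such that the $t$-th binary digit of $i$ is $1$; * the edge $l_i^{r-1}v_j$ whenever $u_i\in S_j$; * a path $a^0,\dots,a^{r-1}$, where $a^0$ is joined to all vertices of $B^\Omega_t$ for every $t\in[\mathrm{len}(n+1)]$, and $a^{r-1}$ is joined to $v_j$ and $\bar v_j$ for every $j\in[m]$.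 **Theorem.** Let $(\Omega,\mathcal S)$ be an instance of Hitting Set with $|\Omega|=n\ge1$ and $|\mathcal S|=m$, and let $k$ be an integer with $0\le k\le n$. Let $f$ be a $1$-layered distance identifying function, $r\in\{1,2,\dots\}\cup\{\infty\}$, and $(H,B,C)$ an $(f,r)$-gadget with $B\neq\emptyset$. Let $g$ be a distance identifying function, $q\ge1$ an integer, and $(H',B',C')$ a local $(g,q)$-gadget. Then the following are equivalent: 1. there exists a hitting set of $\mathcal S$ of size $k$; 2. there exists an $(f,r)$-distance identifying set of $\Psi[H,B,1](\Omega,\mathcal S)$ of size $k+|C|(\mathrm{len}(n+1)+\mathrm{len}(m))$; 3. there exists a $(g,q)$-distance identifying set of $\Psi[H',B',q](\Omega,\mathcal S)$ of size $k+|C'|(\mathrm{len}(n+1)+\mathrm{len}(m))$. -/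

import Mathlib

universe u

/-! Conventions: graphs are finite and simple; the distance is the number of edges of a shortest
path, `∞` between different components, i.e. `SimpleGraph.edist`. A range in
`{1, 2, …} ∪ {∞}` is an element `r ≠ 0` of `ℕ∞`. -/

/-- An identifying function: for every finite graph `G`, a truth value `f_G[w](u,v)`,
symmetric in `u` and `v`. (The value at `u = v` is never used.) -/
structure IdentifyingFunction where
  rel : ∀ {V : Type u} [Finite V], SimpleGraph V → V → V → V → Prop
  symm : ∀ {V : Type u} [Finite V] (G : SimpleGraph V) (w u v : V),
    rel G w u v ↔ rel G w v u

namespace IdentifyingFunction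

/-- A vertex does not distinguish two vertices at the same distance from it. -/
def IsDistance (f : IdentifyingFunction.{u}) : Prop :=
  ∀ {V : Type u} [Finite V] (G : SimpleGraph V) (w u v : V), u ≠ v →
    G.edist u w = G.edist v w → ¬ f.rel G w u v

/-- `i`-local functions. -/
def IsLocal (f : IdentifyingFunction.{u}) (i : ℕ∞) : Prop :=
  ∀ {V : Type u} [Finite V] (G : SimpleGraph V) (w u v : V), u ≠ v →
    ((G.edist u w ≤ i ∧ i < G.edist v w) ∨ (G.edist v w ≤ i ∧ i < G.edist u w) →
      f.rel G w u v) ∧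
    (i < min (G.edist u w) (G.edist v w) → ¬ f.rel G w u v)

/-- `i`-layered functions. -/
def IsLayered (f : IdentifyingFunction.{u}) (i : ℕ∞) : Prop :=
  ∀ {V : Type u} [Finite V] (G : SimpleGraph V) (w u v : V), u ≠ v →
    min (G.edist u w) (G.edist v w) ≤ i → G.edist u w ≠ G.edist v w → f.rel G w u v

/-- `C` `f`-distinguishes `X` and `Y` in the graph `G`. -/
def Distinguishes (f : IdentifyingFunction.{u}) {V : Type u} [Finite V] (G : SimpleGraph V)
    (C X Y : Set V) : Prop :=
  ∀ x ∈ X, ∀ y ∈ Y, x = y ∨ ∃ w ∈ C, f.rel G w x y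

end IdentifyingFunction

/-- `r`-dominating sets. The `r`-neighbourhood of a vertex consists of the vertices at distance less
than `r + 1`; for `r = ∞` it is the connected component. -/
def IsDominatingSet {V : Type u} (G : SimpleGraph V) (r : ℕ∞) (D : Set V) : Prop :=
  ∀ x : V, ∃ y ∈ D, G.edist x y < r + 1

/-- `(f,r)`-distance identifying sets. -/
structure IsDistanceIdentifyingSet (f : IdentifyingFunction.{u}) (r : ℕ∞) {V : Type u} [Finite V]
    (G : SimpleGraph V) (S : Set V) : Prop where
  dominating : IsDominatingSet G r S
  distinguishes : f.Distinguishes G S Set.univ Set.univ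

/-- `G`, with the copy of `H` embedded by `e` as an induced subgraph, is a `B`-extension of `H`. -/
structure IsExtension {V W : Type u} (H : SimpleGraph V) (B : Set V) (G : SimpleGraph W)
    (e : H ↪g G) : Prop where
  connected : G.Connected
  border : ∀ v ∉ Set.range e, {x | G.Adj v (e x)} = ∅ ∨ {x | G.Adj v (e x)} = B

/-- The set `N_B` of the `B`-adjacent vertices of an extension. -/
def borderAdjacent {V W : Type u} {H : SimpleGraph V} (B : Set V) {G : SimpleGraph W}
    (e : H ↪g G) : Set W :=
  {v | v ∉ Set.range e ∧ {x | G.Adj v (e x)} = B}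

/-- `(H,B,C)` is an `(f,r)`-gadget: four conditions for every `B`-extension `G` of `H`. -/
structure IsGadget (f : IdentifyingFunction.{u}) (r : ℕ∞) {V : Type u}
    (H : SimpleGraph V) (B C : Set V) : Prop where
  connected : H.Connected
  distinguishes_copy : ∀ {W : Type u} [Finite W] (G : SimpleGraph W) (e : H ↪g G),
    IsExtension H B G e → f.Distinguishes G (e '' C) (Set.range e) Set.univ
  distinguishes_border : ∀ {W : Type u} [Finite W] (G : SimpleGraph W) (e : H ↪g G),
    IsExtension H B G e →
      f.Distinguishes G (e '' C) (borderAdjacent B e) ((Set.range e)ᶜ \ borderAdjacent B e)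
  dominating : ∀ {W : Type u} [Finite W] (G : SimpleGraph W) (e : H ↪g G),
    IsExtension H B G e →
      IsDominatingSet (G.induce (Set.range e ∪ borderAdjacent B e)) r
        (Subtype.val ⁻¹' (e '' C))
  card_le : ∀ {W : Type u} [Finite W] (G : SimpleGraph W) (e : H ↪g G),
    IsExtension H B G e → ∀ S : Set W, IsDistanceIdentifyingSet f r G S →
      C.ncard ≤ (S ∩ Set.range e).ncard

/-- Local `(f,q)`-gadgets: `f` is `q`-local for a finite `q ≥ 1`, and `C` contains a vertex
at each of the distances `0, …, q - 1` from `B`. -/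
structure IsLocalGadget (f : IdentifyingFunction.{u}) (q : ℕ) {V : Type u}
    (H : SimpleGraph V) (B C : Set V) : Prop where
  pos : 1 ≤ q
  isLocal : f.IsLocal q
  gadget : IsGadget f q H B C
  exists_dist : ∀ k ∈ Finset.Icc 1 q, ∃ c ∈ C, ⨅ b ∈ B, H.edist c b = ((k - 1 : ℕ) : ℕ∞)

/-- An instance of Hitting Set with universe `u_1, …, u_n` and sets `S_1, …, S_m`; the index
`i : Fin n` stands for `u_{i+1}` and `j : Fin m` for `S_{j+1}`. -/
structure HittingSetInstance (n m : ℕ) where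
  sets : Fin m → Finset (Fin n)
  nonempty : ∀ j, (sets j).Nonempty
  covers : ∀ i, ∃ j, i ∈ sets j

/-- Hitting sets. -/
def HittingSetInstance.IsHittingSet {n m : ℕ} (I : HittingSetInstance n m) (P : Finset (Fin n)) :
    Prop :=
  ∀ j, (I.sets j ∩ P).Nonempty

/-- The number of binary digits `1 + ⌊log₂ n⌋` of a positive integer. -/
def binLen (n : ℕ) : ℕ := 1 + Nat.log 2 n

/-- The vertices of the compressed graph. Indices start at `0`. -/
inductive CompressedVertex (V : Type u) (n m r : ℕ) : Type u
  /-- the vertex `x` in the `t`-th copy of the gadget on the side of the elements -/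
  | elemGadget (t : Fin (binLen (n + 1))) (x : V) : CompressedVertex V n m r
  /-- the vertex `x` in the `t`-th copy of the gadget on the side of the sets -/
  | setGadget (t : Fin (binLen m)) (x : V) : CompressedVertex V n m r
  /-- the `k`-th vertex `l_i^k` of the path of element `i`; the vertex of `u_i` itself is `l_i^0` -/
  | elem (i : Fin n) (k : Fin r) : CompressedVertex V n m r
  /-- the `k`-th vertex `a^k` of the apex path -/
  | apex (k : Fin r) : CompressedVertex V n m r
  /-- the vertex `v_j` of the set `j` -/
  | pos (j : Fin m) : CompressedVertex V n m r
  /-- the vertex `v̄_j` of the set `j` -/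
  | neg (j : Fin m) : CompressedVertex V n m r

instance CompressedVertex.instFinite (V : Type u) [Finite V] (n m r : ℕ) :
    Finite (CompressedVertex V n m r) := by
  let F : CompressedVertex V n m r →
      (Fin (binLen (n + 1)) × V) ⊕ (Fin (binLen m) × V) ⊕ (Fin n × Fin r) ⊕ Fin r ⊕ Fin m ⊕ Fin m :=
    fun v => match v with
    | .elemGadget t x => .inl (t, x)
    | .setGadget t x => .inr (.inl (t, x))
    | .elem i k => .inr (.inr (.inl (i, k)))
    | .apex k => .inr (.inr (.inr (.inl k)))
    | .pos j => .inr (.inr (.inr (.inr (.inl j))))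
    | .neg j => .inr (.inr (.inr (.inr (.inr j))))
  refine Finite.of_injective F ?_
  intro a b h
  cases a <;> cases b <;> simp_all [F]

/-- The edges of the compressed graph, each listed in one direction. Element `i : Fin n` has the
number `i + 1` and set `j : Fin m` the number `j + 1`; their binary digits select the
gadget copies. -/
inductive CompressedEdge {V : Type u} (H : SimpleGraph V) (B : Set V) {n m : ℕ}
    (I : HittingSetInstance n m) (r : ℕ) :
    CompressedVertex V n m r → CompressedVertex V n m r → Prop
  | elemGadget (t : Fin (binLen (n + 1))) (x y : V) : H.Adj x y →
      CompressedEdge H B I r (.elemGadget t x) (.elemGadget t y)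
  | setGadget (t : Fin (binLen m)) (x y : V) : H.Adj x y →
      CompressedEdge H B I r (.setGadget t x) (.setGadget t y)
  | pos_border (j : Fin m) (t : Fin (binLen m)) (b : V) : b ∈ B →
      Nat.testBit (j + 1) t = true →
      CompressedEdge H B I r (.pos j) (.setGadget t b)
  | neg_border (j : Fin m) (t : Fin (binLen m)) (b : V) : b ∈ B →
      Nat.testBit (j + 1) t = true →
      CompressedEdge H B I r (.neg j) (.setGadget t b)
  | elem_border (i : Fin n) (k : Fin r) (t : Fin (binLen (n + 1))) (b : V) : b ∈ B →
      (k : ℕ) = 0 → Nat.testBit (i + 1) t = true →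
      CompressedEdge H B I r (.elem i k) (.elemGadget t b)
  | elem_path (i : Fin n) (k k' : Fin r) : (k' : ℕ) = k + 1 →
      CompressedEdge H B I r (.elem i k) (.elem i k')
  | elem_pos (i : Fin n) (k : Fin r) (j : Fin m) : (k : ℕ) + 1 = r → i ∈ I.sets j →
      CompressedEdge H B I r (.elem i k) (.pos j)
  | apex_border (k : Fin r) (t : Fin (binLen (n + 1))) (b : V) : b ∈ B → (k : ℕ) = 0 →
      CompressedEdge H B I r (.apex k) (.elemGadget t b)
  | apex_path (k k' : Fin r) : (k' : ℕ) = k + 1 →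
      CompressedEdge H B I r (.apex k) (.apex k')
  | apex_pos (k : Fin r) (j : Fin m) : (k : ℕ) + 1 = r →
      CompressedEdge H B I r (.apex k) (.pos j)
  | apex_neg (k : Fin r) (j : Fin m) : (k : ℕ) + 1 = r →
      CompressedEdge H B I r (.apex k) (.neg j)

/-- The compressed graph `Ψ[H,B,r](Ω,𝒮)`. -/
def compressedGraph {V : Type u} (H : SimpleGraph V) (B : Set V) {n m : ℕ}
    (I : HittingSetInstance n m) (r : ℕ) : SimpleGraph (CompressedVertex V n m r) :=
  SimpleGraph.fromRel (CompressedEdge H B I r)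

/-! From an identifying set to a hitting set: every gadget copy sits in the compressed graph as part
of a `B`-extension, so each copy already takes at least |C| vertices of the set, and at most k
vertices remain outside the copies. Two graph homomorphisms (`unbarMap`, `barMap`) show that v_j and
v̄_j are equidistant from every vertex except themselves and the path vertices of elements of S_j.
Hence each outer vertex can be traded for one element so that all sets are hit
(`exists_hittingSet_of_isDistanceIdentifyingSet`).

Conversely, take C in every copy together with l_i^0 for each i in the hitting set. The gadget
axioms distinguish any pair that meets a copy and any two outer vertices attached to different
copies; binary numbering gives distinct sets and distinct path starts different attachments. What is
left (`isDistanceIdentifyingSet_of_forall_path`) is v_j against v̄_j, settled by a chosen l_i^0 with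
i in S_j, which is within r of v_j but farther than r from v̄_j, and the path vertices. For paths of
length one the numbering suffices; for a local gadget, a vertex of C at distance q - 1 - k from `B`
reaches the k-th path vertices of its attached paths at range q, but none further along. -/

/-! ### Distance bounds from homomorphisms and potentials -/

namespace SimpleGraph

variable {V W : Type*} {G : SimpleGraph V} {G' : SimpleGraph W}

theorem edist_map_le (φ : G →g G') (x y : V) : G'.edist (φ x) (φ y) ≤ G.edist x y := by
  by_cases h : G.edist x y = ⊤
  · simp [h]
  · obtain ⟨p, hp⟩ := exists_walk_of_edist_ne_top h
    rw [← hp, ← Walk.length_map φ p]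
    exact edist_le _

theorem Walk.le_add_length {φ : V → ℕ} (hφ : ∀ x y, G.Adj x y → φ y ≤ φ x + 1) {x y : V}
    (p : G.Walk x y) : φ y ≤ φ x + p.length := by
  induction p with
  | nil => simp
  | cons h p ih =>
    have := hφ _ _ h
    rw [Walk.length_cons]
    omega

/-- A potential that grows by at most one along each edge certifies a lower bound on distance; all
strict lower bounds below come from such certificates. -/
theorem le_edist_of_lipschitz {φ : V → ℕ} (hφ : ∀ x y, G.Adj x y → φ y ≤ φ x + 1) {x y : V}
    {k : ℕ} (h : φ x + k ≤ φ y) : (k : ℕ∞) ≤ G.edist x y := by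
  by_cases ht : G.edist x y = ⊤
  · simp [ht]
  · obtain ⟨p, hp⟩ := exists_walk_of_edist_ne_top ht
    have := p.le_add_length hφ
    rw [← hp]
    exact_mod_cast (by omega : k ≤ p.length)

end SimpleGraph

/-! ### Binary digits -/

theorem lt_binLen_of_testBit {x y t : ℕ} (hxy : x ≤ y) (h : Nat.testBit x t = true) :
    t < binLen y := by
  have h1 : 2 ^ t ≤ x := by
    by_contra! hlt
    simp [Nat.testBit_lt_two_pow hlt] at h
  have := Nat.le_log_of_pow_le (b := 2) (by norm_num) (h1.trans hxy)
  unfold binLen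
  omega

theorem exists_testBit_lt_binLen {x y : ℕ} (hx : x ≠ 0) (hxy : x ≤ y) :
    ∃ t : Fin (binLen y), Nat.testBit x t = true := by
  obtain ⟨t, ht⟩ := Nat.exists_testBit_of_ne_zero hx
  exact ⟨⟨t, lt_binLen_of_testBit hxy ht⟩, ht⟩

theorem lt_two_pow_binLen (y : ℕ) : y < 2 ^ binLen y := by
  rw [binLen, add_comm]
  exact Nat.lt_pow_succ_log_self (by norm_num) y

theorem exists_testBit_ne_of_lt_two_pow {l x y : ℕ} (hx : x < 2 ^ l) (hy : y < 2 ^ l)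
    (hxy : x ≠ y) : ∃ t : Fin l, Nat.testBit x t ≠ Nat.testBit y t := by
  by_contra! h
  refine hxy (Nat.eq_of_testBit_eq fun i => ?_)
  by_cases hi : i < l
  · exact h ⟨i, hi⟩
  · have : 2 ^ l ≤ 2 ^ i := Nat.pow_le_pow_right (by norm_num) (by omega)
    rw [Nat.testBit_lt_two_pow (by omega), Nat.testBit_lt_two_pow (by omega)]

/-- The power 2^t is itself one of the numbers 1, …, l. This guarantees that no gadget copy on the
set side is left isolated. -/
theorem exists_testBit_of_lt_binLen {l : ℕ} (hl : l ≠ 0) (t : Fin (binLen l)) :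
    ∃ j : Fin l, Nat.testBit (j + 1) t = true := by
  have h1 : 2 ^ (t : ℕ) ≤ l := by
    refine Nat.pow_le_of_le_log hl ?_
    have := t.2
    unfold binLen at this
    omega
  have h2 := Nat.one_le_two_pow (n := (t : ℕ))
  refine ⟨⟨2 ^ (t : ℕ) - 1, by omega⟩, ?_⟩
  simp only
  rw [Nat.sub_add_cancel h2]
  exact Nat.testBit_two_pow_self

/-! ### The compressed graph as an extension of each gadget copy -/

/-- The gadget copies of the compressed graph. -/
abbrev GadgetCopy (n m : ℕ) : Type := Fin (binLen (n + 1)) ⊕ Fin (binLen m)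

namespace CompressedVertex

variable {V : Type u} {n m r : ℕ}

/-- The vertex `x` in the copy `s` of the gadget. -/
def copy (s : GadgetCopy n m) (x : V) : CompressedVertex V n m r :=
  match s with
  | .inl t => .elemGadget t x
  | .inr t => .setGadget t x

/-- The vertex outside the gadget copies is joined to the border of the copy `s`. -/
def Attached : CompressedVertex V n m r → GadgetCopy n m → Prop
  | .elem i k, .inl t => (k : ℕ) = 0 ∧ Nat.testBit (i + 1) t = true
  | .apex k, .inl _ => (k : ℕ) = 0
  | .pos j, .inr t => Nat.testBit (j + 1) t = true
  | .neg j, .inr t => Nat.testBit (j + 1) t = true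
  | _, _ => False

theorem copy_injective2 {s s' : GadgetCopy n m} {x x' : V} :
    (copy s x : CompressedVertex V n m r) = copy s' x' ↔ s = s' ∧ x = x' := by
  cases s <;> cases s' <;> simp [copy]

/-- The vertex lies outside all gadget copies. -/
def IsOuter (v : CompressedVertex V n m r) : Prop := ∀ s x, v ≠ copy s x

theorem isOuter_or_eq_copy (v : CompressedVertex V n m r) :
    v.IsOuter ∨ ∃ s x, v = copy s x := by
  by_cases h : ∃ s x, v = copy s x
  · exact .inr h
  · exact .inl fun s x hx => h ⟨s, x, hx⟩

@[simp] theorem isOuter_elem (i : Fin n) (k : Fin r) :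
    (elem i k : CompressedVertex V n m r).IsOuter := by
  rintro (s | s) x <;> simp [copy]

@[simp] theorem isOuter_pos (j : Fin m) : (pos j : CompressedVertex V n m r).IsOuter := by
  rintro (s | s) x <;> simp [copy]

@[simp] theorem isOuter_neg (j : Fin m) : (neg j : CompressedVertex V n m r).IsOuter := by
  rintro (s | s) x <;> simp [copy]

end CompressedVertex

open CompressedVertex

section Structure

variable {V : Type u} {H : SimpleGraph V} {B : Set V} {n m r : ℕ} {I : HittingSetInstance n m}

theorem HittingSetInstance.sets_ne_zero (I : HittingSetInstance n m) (hn : 0 < n) : m ≠ 0 := by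
  obtain ⟨j, -⟩ := I.covers ⟨0, hn⟩
  exact (Fin.pos j).ne'

theorem compressedGraph_adj_of_edge {v w : CompressedVertex V n m r}
    (h : CompressedEdge H B I r v w) : (compressedGraph H B I r).Adj v w := by
  refine (SimpleGraph.fromRel_adj _ _ _).2 ⟨?_, .inl h⟩
  rintro rfl
  rcases h with ⟨_, _, _, h⟩ | ⟨_, _, _, h⟩ | _ | _ | _ | ⟨_, _, _, h⟩ | _ | _ | ⟨_, _, h⟩ | _ | _
  · exact h.ne rfl
  · exact h.ne rfl
  · omega
  · omega

theorem edge_of_compressedGraph_adj {v w : CompressedVertex V n m r}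
    (h : (compressedGraph H B I r).Adj v w) :
    CompressedEdge H B I r v w ∨ CompressedEdge H B I r w v :=
  ((SimpleGraph.fromRel_adj _ _ _).1 h).2

theorem compressedGraph_adj_copy {v : CompressedVertex V n m r} {s : GadgetCopy n m} {x : V} :
    (compressedGraph H B I r).Adj v (copy s x) ↔
      (∃ y, v = copy s y ∧ H.Adj y x) ∨ (v.Attached s ∧ x ∈ B) := by
  constructor
  · intro h
    rcases edge_of_compressedGraph_adj h with h | h <;> rcases s with s | s <;>
      simp only [copy] at h <;> cases h <;> simp_all [copy, Attached, H.adj_comm]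
  · rintro (⟨y, rfl, h⟩ | ⟨h, hx⟩)
    · rcases s with s | s
      · exact compressedGraph_adj_of_edge (.elemGadget _ _ _ h)
      · exact compressedGraph_adj_of_edge (.setGadget _ _ _ h)
    · rcases s with s | s <;> cases v <;> simp only [Attached] at h
      · exact compressedGraph_adj_of_edge (.elem_border _ _ _ _ hx h.1 h.2)
      · exact compressedGraph_adj_of_edge (.apex_border _ _ _ hx h)
      · exact compressedGraph_adj_of_edge (.pos_border _ _ _ hx h)
      · exact compressedGraph_adj_of_edge (.neg_border _ _ _ hx h)

theorem not_attached_copy (s s' : GadgetCopy n m) (x : V) :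
    ¬ (copy s x : CompressedVertex V n m r).Attached s' := by
  rcases s with s | s <;> rcases s' with s' | s' <;> simp [copy, Attached]

/-- The copy `s` of the gadget as an induced subgraph of the compressed graph. -/
def copyEmbedding {V : Type u} (H : SimpleGraph V) (B : Set V) {n m : ℕ}
    (I : HittingSetInstance n m) (r : ℕ) (s : GadgetCopy n m) :
    H ↪g compressedGraph H B I r where
  toFun := copy s
  inj' _ _ h := (copy_injective2.1 h).2
  map_rel_iff' {x y} := by
    change (compressedGraph H B I r).Adj (copy s x) (copy s y) ↔ H.Adj x y
    rw [compressedGraph_adj_copy]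
    simp [copy_injective2, not_attached_copy]

@[simp] theorem copyEmbedding_apply (s : GadgetCopy n m) (x : V) :
    copyEmbedding H B I r s x = copy s x := rfl

theorem setOf_adj_copy {v : CompressedVertex V n m r} {s : GadgetCopy n m}
    (hv : v ∉ Set.range (copyEmbedding H B I r s)) :
    {x | (compressedGraph H B I r).Adj v (copyEmbedding H B I r s x)} =
      {x | v.Attached s ∧ x ∈ B} := by
  ext x
  simp only [copyEmbedding_apply, Set.mem_ofPred_eq, compressedGraph_adj_copy, or_iff_right_iff_imp]
  rintro ⟨y, rfl, -⟩
  exact (hv ⟨y, rfl⟩).elim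

theorem compressedGraph_connected (hH : H.Connected) (hB : B.Nonempty) (hr : 0 < r)
    (hn : 0 < n) : (compressedGraph H B I r).Connected := by
  obtain ⟨b, hb⟩ := hB
  -- `binLen 0 = 1`, so with no sets there would be a detached copy on the set side.
  have hm := I.sets_ne_zero hn
  set G := compressedGraph H B I r with hG
  have adj {v w} (h : CompressedEdge H B I r v w) : G.Reachable v w :=
    (compressedGraph_adj_of_edge h).reachable
  have hcopy (s : GadgetCopy n m) (x y : V) : G.Reachable (copy s x) (copy s y) :=
    (hH x y).map (copyEmbedding H B I r s).toHom
  have hapex (l : ℕ) (hl : l < r) : G.Reachable (apex ⟨l, hl⟩) (apex ⟨0, hr⟩) := by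
    induction l with
    | zero => exact .rfl
    | succ l ih => exact (adj (.apex_path ⟨l, by omega⟩ _ rfl)).symm.trans (ih _)
  have helem (i : Fin n) (l : ℕ) (hl : l < r) : G.Reachable (elem i ⟨l, hl⟩) (elem i ⟨0, hr⟩) := by
    induction l with
    | zero => exact .rfl
    | succ l ih => exact (adj (.elem_path i ⟨l, by omega⟩ _ rfl)).symm.trans (ih _)
  have hpos (j : Fin m) : G.Reachable (pos j) (apex ⟨0, hr⟩) :=
    (adj (.apex_pos ⟨r - 1, by omega⟩ j (by simp; omega))).symm.trans (hapex _ _)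
  -- The vertex a^0 serves as hub: it touches every copy on the element side, and the apex path
  -- leads to every v_j and v̄_j.
  have key (v : CompressedVertex V n m r) : G.Reachable v (apex ⟨0, hr⟩) := by
    cases v with
    | elemGadget t x =>
      exact (hcopy (.inl t) x b).trans (adj (.apex_border _ t b hb rfl)).symm
    | setGadget t x =>
      obtain ⟨j, hj⟩ := exists_testBit_of_lt_binLen hm t
      exact ((hcopy (.inr t) x b).trans (adj (.pos_border j t b hb hj)).symm).trans (hpos j)
    | elem i k =>
      obtain ⟨t, ht⟩ := exists_testBit_lt_binLen (x := i + 1) (y := n + 1) (by omega) (by omega)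
      exact ((helem i k k.2).trans (adj (.elem_border i _ t b hb rfl ht))).trans
        (adj (.apex_border _ t b hb rfl)).symm
    | apex k => exact hapex k k.2
    | pos j => exact hpos j
    | neg j => exact (adj (.apex_neg ⟨r - 1, by omega⟩ j (by simp; omega))).symm.trans (hapex _ _)
  have : Nonempty (CompressedVertex V n m r) := ⟨apex ⟨0, hr⟩⟩
  exact ⟨fun v w => (key v).trans (key w).symm⟩

theorem isExtension_copyEmbedding (hH : H.Connected) (hB : B.Nonempty) (hr : 0 < r)
    (hn : 0 < n) (s : GadgetCopy n m) :
    IsExtension H B (compressedGraph H B I r) (copyEmbedding H B I r s) where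
  connected := compressedGraph_connected hH hB hr hn
  border v hv := by
    rw [setOf_adj_copy hv]
    by_cases h : v.Attached s <;> simp [h]

theorem mem_borderAdjacent_copyEmbedding (hB : B.Nonempty) {s : GadgetCopy n m}
    {v : CompressedVertex V n m r} :
    v ∈ borderAdjacent B (copyEmbedding H B I r s) ↔ v.Attached s := by
  obtain ⟨b, hb⟩ := hB
  constructor
  · rintro ⟨hv, h⟩
    rw [setOf_adj_copy hv] at h
    exact (h.symm ▸ hb : b ∈ {x | v.Attached s ∧ x ∈ B}).1
  · intro h
    have hv : v ∉ Set.range (copyEmbedding H B I r s) := by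
      rintro ⟨x, rfl⟩
      exact not_attached_copy _ _ _ h
    refine ⟨hv, ?_⟩
    rw [setOf_adj_copy hv]
    simp [h]

end Structure

/-! ### From identifying sets to hitting sets -/

section Backward

variable {V : Type u} {H : SimpleGraph V} {B : Set V} {n m r : ℕ} {I : HittingSetInstance n m}

open Classical in
/-- Sends `v̄_j` to `v_j` and fixes all other vertices. -/
noncomputable def unbarMap (j : Fin m) (v : CompressedVertex V n m r) : CompressedVertex V n m r :=
  if v = neg j then pos j else v

open Classical in
/-- Sends `v_j` to `v̄_j` and the paths of the elements of `S_j` to the apex path, and fixes all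
other vertices. -/
def barMap (I : HittingSetInstance n m) (j : Fin m) :
    CompressedVertex V n m r → CompressedVertex V n m r
  | .elem i k => if i ∈ I.sets j then .apex k else .elem i k
  | .pos j' => if j' = j then .neg j else .pos j'
  | v => v

/-- Every neighbour of v̄_j is also a neighbour of v_j. -/
theorem compressedGraph_adj_unbarMap (j : Fin m) {v w : CompressedVertex V n m r}
    (h : CompressedEdge H B I r v w) :
    (compressedGraph H B I r).Adj (unbarMap j v) (unbarMap j w) := by
  have h' := compressedGraph_adj_of_edge h
  cases h with
  | neg_border j' t b hb ht =>
    by_cases hj : j' = j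
    · subst hj
      simpa [unbarMap] using compressedGraph_adj_of_edge (.pos_border j' t b hb ht)
    · simpa [unbarMap, hj] using h'
  | apex_neg k j' hk =>
    by_cases hj : j' = j
    · subst hj
      simpa [unbarMap] using compressedGraph_adj_of_edge (.apex_pos k j' hk)
    · simpa [unbarMap, hj] using h'
  | _ => simpa [unbarMap] using h'

/-- The neighbours of v_j missing at v̄_j are the ends of the paths of elements of S_j. Folding
these paths onto the apex path preserves edges because a^0 is joined to all borders on the element
side and a^{r-1} to all v_j and v̄_j. -/
theorem compressedGraph_adj_barMap (j : Fin m) {v w : CompressedVertex V n m r}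
    (h : CompressedEdge H B I r v w) :
    (compressedGraph H B I r).Adj (barMap I j v) (barMap I j w) := by
  have h' := compressedGraph_adj_of_edge h
  cases h with
  | pos_border j' t b hb ht =>
    by_cases hj : j' = j
    · subst hj
      simpa [barMap] using compressedGraph_adj_of_edge (.neg_border j' t b hb ht)
    · simpa [barMap, hj] using h'
  | apex_pos k j' hk =>
    by_cases hj : j' = j
    · subst hj
      simpa [barMap] using compressedGraph_adj_of_edge (.apex_neg k j' hk)
    · simpa [barMap, hj] using h'
  | elem_border i k t b hb hk ht =>
    by_cases hi : i ∈ I.sets j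
    · simpa [barMap, hi] using compressedGraph_adj_of_edge (.apex_border k t b hb hk)
    · simpa [barMap, hi] using h'
  | elem_path i k k' hk =>
    by_cases hi : i ∈ I.sets j
    · simpa [barMap, hi] using compressedGraph_adj_of_edge (.apex_path k k' hk)
    · simpa [barMap, hi] using h'
  | elem_pos i k j' hk hij =>
    by_cases hj : j' = j
    · subst hj
      simpa [barMap, hij] using compressedGraph_adj_of_edge (.apex_neg k j' hk)
    · by_cases hi : i ∈ I.sets j
      · simpa [barMap, hi, hj] using compressedGraph_adj_of_edge (.apex_pos k j' hk)
      · simpa [barMap, hi, hj] using h'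
  | _ => simpa [barMap] using h'

/-- A map sending edges to edges as a homomorphism of the compressed graph. -/
def compressedHom (φ : CompressedVertex V n m r → CompressedVertex V n m r)
    (hφ : ∀ v w, CompressedEdge H B I r v w → (compressedGraph H B I r).Adj (φ v) (φ w)) :
    compressedGraph H B I r →g compressedGraph H B I r where
  toFun := φ
  map_rel' {v w} h := (edge_of_compressedGraph_adj h).elim (hφ v w) fun h => (hφ w v h).symm

/-- Both homomorphisms fix w and they exchange the roles of v_j and v̄_j, giving one inequality
each. The second hypothesis also excludes w = v_j. -/
theorem edist_pos_eq_edist_neg {j : Fin m} {w : CompressedVertex V n m r}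
    (h1 : w ≠ neg j) (h2 : barMap I j w = w) :
    (compressedGraph H B I r).edist (pos j) w = (compressedGraph H B I r).edist (neg j) w := by
  apply le_antisymm
  · have := SimpleGraph.edist_map_le (compressedHom (H := H) (B := B) (I := I) (r := r)
      (unbarMap j) fun _ _ => compressedGraph_adj_unbarMap j) (neg j) w
    simpa [compressedHom, unbarMap, h1] using this
  · have := SimpleGraph.edist_map_le (compressedHom (H := H) (B := B) (I := I) (r := r)
      (barMap I j) fun _ _ => compressedGraph_adj_barMap j) (pos j) w
    simp only [compressedHom, RelHom.coeFn_mk, h2] at this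
    simpa [barMap] using this

/-- An element lying in every set `S_j` whose vertices `v_j` and `v̄_j` the outer vertex
distinguishes. -/
noncomputable def chosenElement (I : HittingSetInstance n m) (i₀ : Fin n) :
    CompressedVertex V n m r → Fin n
  | .elem i _ => i
  | .pos j => (I.nonempty j).choose
  | .neg j => (I.nonempty j).choose
  | _ => i₀

theorem chosenElement_mem_or_edist_eq (i₀ : Fin n) (j : Fin m) (w : CompressedVertex V n m r) :
    (w.IsOuter ∧ chosenElement I i₀ w ∈ I.sets j) ∨ (compressedGraph H B I r).edist (pos j) w =
      (compressedGraph H B I r).edist (neg j) w := by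
  rcases w with ⟨t, x⟩ | ⟨t, x⟩ | ⟨i, k⟩ | k | j' | j'
  · exact .inr (edist_pos_eq_edist_neg (by simp) rfl)
  · exact .inr (edist_pos_eq_edist_neg (by simp) rfl)
  · by_cases hi : i ∈ I.sets j
    · exact .inl ⟨isOuter_elem _ _, hi⟩
    · exact .inr (edist_pos_eq_edist_neg (by simp) (by simp [barMap, hi]))
  · exact .inr (edist_pos_eq_edist_neg (by simp) rfl)
  · by_cases hj : j' = j
    · subst hj
      exact .inl ⟨isOuter_pos _, (I.nonempty j').choose_spec⟩
    · exact .inr (edist_pos_eq_edist_neg (by simp) (by simp [barMap, hj]))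
  · by_cases hj : j' = j
    · subst hj
      exact .inl ⟨isOuter_neg _, (I.nonempty j').choose_spec⟩
    · exact .inr (edist_pos_eq_edist_neg (by simp [hj]) rfl)

theorem ncard_eq_outer_add_sum [Finite V] (S : Set (CompressedVertex V n m r)) :
    S.ncard = (S ∩ {v | v.IsOuter}).ncard +
      ∑ s : GadgetCopy n m, (S ∩ Set.range (copy s)).ncard := by
  have hU : S ∩ {v | v.IsOuter}ᶜ = ⋃ s : GadgetCopy n m, S ∩ Set.range (copy s) := by
    ext v
    simp only [Set.mem_inter_iff, Set.mem_compl_iff, Set.mem_ofPred_eq, Set.mem_iUnion,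
      Set.mem_range, exists_and_left, and_congr_right_iff]
    intro _
    simp only [IsOuter, not_forall, not_not, eq_comm]
  have h1 : (⋃ s : GadgetCopy n m, S ∩ Set.range (copy s)).encard =
      ∑ s : GadgetCopy n m, (S ∩ Set.range (copy s)).encard := by
    rw [Set.encard_iUnion_of_finite, finsum_eq_sum_of_fintype]
    intro s s' hs
    rw [Function.onFun, Set.disjoint_left]
    rintro _ ⟨-, x, rfl⟩ ⟨-, x', h⟩
    exact hs (copy_injective2.1 h).1.symm
  have h2 := Set.encard_sdiff_add_encard_inter S {v : CompressedVertex V n m r | v.IsOuter}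
  rw [Set.sdiff_eq, hU, h1] at h2
  simp only [← Set.Finite.cast_ncard_eq (Set.toFinite _)] at h2
  norm_cast at h2
  omega

theorem card_gadgetCopy (n m : ℕ) :
    Fintype.card (GadgetCopy n m) = binLen (n + 1) + binLen m := by simp

theorem exists_hittingSet_of_isDistanceIdentifyingSet (hn : 0 < n) (hr : 0 < r)
    {f : IdentifyingFunction.{u}} (hf : f.IsDistance) {ρ : ℕ∞} [Finite V] {C : Set V}
    (hB : B.Nonempty) (hgadget : IsGadget f ρ H B C) {k : ℕ} (hk : k ≤ n)
    {S : Set (CompressedVertex V n m r)}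
    (hS : IsDistanceIdentifyingSet f ρ (compressedGraph H B I r) S)
    (hcard : S.ncard = k + C.ncard * (binLen (n + 1) + binLen m)) :
    ∃ P : Finset (Fin n), I.IsHittingSet P ∧ P.card = k := by
  classical
  -- Gadget condition (iv), summed over the disjoint copies, leaves a budget of k for the outer
  -- vertices.
  have hle : (binLen (n + 1) + binLen m) * C.ncard ≤
      ∑ s : GadgetCopy n m, (S ∩ Set.range (copy s)).ncard := by
    rw [← card_gadgetCopy, ← smul_eq_mul, ← Finset.card_univ]
    exact Finset.card_nsmul_le_sum _ _ _ fun s _ => hgadget.card_le _ _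
      (isExtension_copyEmbedding hgadget.connected hB hr hn s) S hS
  have hout : (S ∩ {v | v.IsOuter}).ncard ≤ k := by
    have := ncard_eq_outer_add_sum S
    rw [mul_comm] at hle
    omega
  set F : Finset (Fin n) :=
    (Set.toFinite (chosenElement I ⟨0, hn⟩ '' (S ∩ {v | v.IsOuter}))).toFinset with hF
  have hFk : F.card ≤ k := by
    rw [hF, ← Set.ncard_eq_toFinset_card]
    exact (Set.ncard_image_le (Set.toFinite _)).trans hout
  -- The chosen elements may be fewer than k; padding to exactly k is possible since k ≤ n and
  -- supersets still hit.
  obtain ⟨P, hFP, -, hP⟩ := Finset.exists_subsuperset_card_eq (Finset.subset_univ F) hFk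
    (by simpa using hk)
  refine ⟨P, fun j => ?_, hP⟩
  obtain h | ⟨w, hw, hd⟩ := hS.distinguishes (pos j) trivial (neg j) trivial
  · simp at h
  · obtain ⟨ho, hi⟩ | he := chosenElement_mem_or_edist_eq (H := H) (B := B) ⟨0, hn⟩ j w
    · refine ⟨_, Finset.mem_inter.2 ⟨hi, hFP ?_⟩⟩
      rw [hF, Set.Finite.mem_toFinset]
      exact ⟨w, ⟨hw, ho⟩, rfl⟩
    · exact (hf _ w _ _ (by simp) he hd).elim

end Backward

/-! ### From hitting sets to identifying sets: reduction to paths and twin pairs -/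

section Forward

variable {V : Type u} {H : SimpleGraph V} {B C : Set V} {n m r : ℕ} {I : HittingSetInstance n m}

namespace CompressedVertex

/-- The `k`-th vertex of the path of an element, or of the apex path for `none`. -/
def path (o : Option (Fin n)) (k : Fin r) : CompressedVertex V n m r :=
  o.elim (apex k) fun i => elem i k

/-- The number whose binary digits select the gadget copies joined to a path. -/
def pathNumber (o : Option (Fin n)) : ℕ :=
  o.elim (2 ^ binLen (n + 1) - 1) fun i => i + 1

theorem pathNumber_lt (o : Option (Fin n)) : pathNumber o < 2 ^ binLen (n + 1) := by
  have := lt_two_pow_binLen (n + 1)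
  rcases o with _ | i
  · simp [pathNumber]
  · simp only [pathNumber, Option.elim_some]
    omega

theorem pathNumber_ne_zero (o : Option (Fin n)) : pathNumber o ≠ 0 := by
  have := lt_two_pow_binLen (n + 1)
  rcases o with _ | i
  · simp only [pathNumber, Option.elim_none]
    omega
  · simp [pathNumber]

/-- Since n + 1 < 2^len(n+1), the all-ones number of the apex exceeds every element number. This is
why len(n+1) copies are used instead of len(n). -/
theorem pathNumber_injective : Function.Injective (pathNumber : Option (Fin n) → ℕ) := by
  have := lt_two_pow_binLen (n + 1)
  rintro (_ | i) (_ | i') h <;> simp only [pathNumber, Option.elim_none, Option.elim_some] at h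
  · rfl
  · omega
  · omega
  · exact congrArg _ (Fin.ext (by omega))

theorem attached_path_inl {o : Option (Fin n)} {k : Fin r} {t : Fin (binLen (n + 1))} :
    (path o k : CompressedVertex V n m r).Attached (.inl t) ↔
      (k : ℕ) = 0 ∧ Nat.testBit (pathNumber o) t = true := by
  cases o <;> simp [path, Attached, pathNumber]

theorem not_attached_path_inr {o : Option (Fin n)} {k : Fin r} {t : Fin (binLen m)} :
    ¬ (path o k : CompressedVertex V n m r).Attached (.inr t) := by
  cases o <;> simp [path, Attached]

theorem exists_testBit_pathNumber (o : Option (Fin n)) :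
    ∃ t : Fin (binLen (n + 1)), Nat.testBit (pathNumber o) t = true := by
  obtain ⟨t, ht⟩ := exists_testBit_ne_of_lt_two_pow (pathNumber_lt o)
    (Nat.two_pow_pos (binLen (n + 1))) (pathNumber_ne_zero o)
  exact ⟨t, by simpa using ht⟩

theorem IsOuter.cases {v : CompressedVertex V n m r} (hv : v.IsOuter) :
    (∃ o k, v = path o k) ∨ ∃ j, v = pos j ∨ v = neg j := by
  cases v with
  | elemGadget t x => exact (hv (.inl t) x rfl).elim
  | setGadget t x => exact (hv (.inr t) x rfl).elim
  | elem i k => exact .inl ⟨some i, k, rfl⟩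
  | apex k => exact .inl ⟨none, k, rfl⟩
  | pos j => exact .inr ⟨j, .inl rfl⟩
  | neg j => exact .inr ⟨j, .inr rfl⟩

theorem attached_set_iff {v : CompressedVertex V n m r} {j : Fin m} (hv : v = pos j ∨ v = neg j)
    (t : Fin (binLen m)) : v.Attached (.inr t) ↔ Nat.testBit (j + 1) t = true := by
  rcases hv with rfl | rfl <;> rfl

theorem exists_attached_set {v : CompressedVertex V n m r} {j : Fin m}
    (hv : v = pos j ∨ v = neg j) : ∃ t, v.Attached (.inr t) := by
  obtain ⟨t, ht⟩ := exists_testBit_lt_binLen (x := j + 1) (y := m) (by omega) (by omega)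
  exact ⟨t, (attached_set_iff hv t).2 ht⟩

end CompressedVertex

/-- The union of the sets `C` of all gadget copies and of the first vertices of the paths of the
elements of `P`. -/
def solutionSet (C : Set V) (P : Finset (Fin n)) (r : ℕ) : Set (CompressedVertex V n m r) :=
  {v | (∃ s, ∃ c ∈ C, v = copy s c) ∨ ∃ i ∈ P, ∃ k : Fin r, (k : ℕ) = 0 ∧ v = elem i k}

theorem copy_mem_solutionSet {P : Finset (Fin n)} (s : GadgetCopy n m) {c : V} (hc : c ∈ C) :
    copy s c ∈ solutionSet C P r := .inl ⟨s, c, hc, rfl⟩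

theorem ncard_solutionSet [Finite V] (hr : 0 < r) (C : Set V) (P : Finset (Fin n)) :
    (solutionSet C P r : Set (CompressedVertex V n m r)).ncard =
      P.card + C.ncard * (binLen (n + 1) + binLen m) := by
  have h1 : (solutionSet C P r : Set (CompressedVertex V n m r)) ∩ {v | v.IsOuter} =
      (fun i => elem i ⟨0, hr⟩) '' (P : Set (Fin n)) := by
    ext v
    constructor
    · rintro ⟨⟨s, c, -, rfl⟩ | ⟨i, hi, k, hk, rfl⟩, h⟩
      · exact (h s c rfl).elim
      · exact ⟨i, hi, congrArg (elem i) (Fin.ext hk.symm)⟩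
    · rintro ⟨i, hi, rfl⟩
      exact ⟨.inr ⟨i, hi, _, rfl, rfl⟩, isOuter_elem _ _⟩
  have h2 (s : GadgetCopy n m) : (solutionSet C P r : Set (CompressedVertex V n m r)) ∩
      Set.range (copy s) = copy s '' C := by
    ext v
    constructor
    · rintro ⟨⟨s', c, hc, rfl⟩ | ⟨i, hi, k, hk, rfl⟩, x, hx⟩
      · obtain ⟨rfl, rfl⟩ := copy_injective2.1 hx
        exact ⟨_, hc, rfl⟩
      · exact (isOuter_elem i k s x hx.symm).elim
    · rintro ⟨c, hc, rfl⟩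
      exact ⟨copy_mem_solutionSet s hc, c, rfl⟩
  have h3 (s : GadgetCopy n m) : (copy s '' C : Set (CompressedVertex V n m r)).ncard = C.ncard :=
    Set.ncard_image_of_injective _ fun _ _ h => (copy_injective2.1 h).2
  rw [ncard_eq_outer_add_sum, h1, Set.ncard_image_of_injective _ fun i i' h => by simpa using h,
    Set.ncard_coe_finset]
  simp only [h2, h3, Finset.sum_const, Finset.card_univ, card_gadgetCopy, smul_eq_mul]
  rw [mul_comm]

/-- The gadget conditions hold in every copy and settle everything except what the hypotheses
supply: domination beyond the path starts, pairs of path vertices with equal attachments, and the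
pairs v_j, v̄_j. -/
theorem isDistanceIdentifyingSet_of_forall_path [Finite V] (hn : 0 < n) (hr : 0 < r)
    {f : IdentifyingFunction.{u}} {ρ : ℕ∞} (hB : B.Nonempty) (hgadget : IsGadget f ρ H B C)
    {S : Set (CompressedVertex V n m r)} (hS : ∀ s, ∀ c ∈ C, copy s c ∈ S)
    (hdom : ∀ o (k : Fin r), (k : ℕ) = 0 ∨
      ∃ y ∈ S, (compressedGraph H B I r).edist (path o k) y < ρ + 1)
    (hpath : ∀ o (k : Fin r) o' (k' : Fin r), k ≤ k' → (o ≠ o' ∨ k ≠ k') →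
      (∀ s, (path o k : CompressedVertex V n m r).Attached s ↔
        (path o' k' : CompressedVertex V n m r).Attached s) →
      ∃ w ∈ S, f.rel (compressedGraph H B I r) w (path o k) (path o' k'))
    (hset : ∀ j, ∃ w ∈ S, f.rel (compressedGraph H B I r) w (pos j) (neg j)) :
    IsDistanceIdentifyingSet f ρ (compressedGraph H B I r) S := by
  set G := compressedGraph H B I r with hG
  have hext (s : GadgetCopy n m) := isExtension_copyEmbedding (I := I) hgadget.connected hB hr hn s
  have hsymm {x y} (h : ∃ w ∈ S, f.rel G w x y) : ∃ w ∈ S, f.rel G w y x := by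
    obtain ⟨w, hw, h⟩ := h
    exact ⟨w, hw, (f.symm G w x y).1 h⟩
  have hcopy (s : GadgetCopy n m) (x : V) (y) : copy s x = y ∨ ∃ w ∈ S, f.rel G w (copy s x) y := by
    obtain h | ⟨_, ⟨c, hc, rfl⟩, h⟩ :=
      hgadget.distinguishes_copy G _ (hext s) _ ⟨x, rfl⟩ y trivial
    · exact .inl h
    · exact .inr ⟨_, hS s c hc, h⟩
  -- Condition (ii): being attached to the copy `s` is detected from inside that copy.
  have hatt {s : GadgetCopy n m} {x y} (hx : x.Attached s) (hy : y.IsOuter)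
      (hys : ¬ y.Attached s) : ∃ w ∈ S, f.rel G w x y := by
    obtain rfl | ⟨_, ⟨c, hc, rfl⟩, h⟩ := hgadget.distinguishes_border G _ (hext s) x
      ((mem_borderAdjacent_copyEmbedding hB).2 hx) y ⟨fun ⟨z, hz⟩ => hy s z hz.symm,
        fun h => hys ((mem_borderAdjacent_copyEmbedding hB).1 h)⟩
    · exact (hys hx).elim
    · exact ⟨_, hS s c hc, h⟩
  constructor
  · have hnear (s : GadgetCopy n m) (x) (hx : x ∈ Set.range (copyEmbedding H B I r s) ∪
        borderAdjacent B (copyEmbedding H B I r s)) : ∃ y ∈ S, G.edist x y < ρ + 1 := by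
      obtain ⟨y, ⟨c, hc, hy⟩, hd⟩ := hgadget.dominating G _ (hext s) ⟨x, hx⟩
      refine ⟨y, hy ▸ hS s c hc, lt_of_le_of_lt ?_ hd⟩
      -- Condition (iii) measures distance in an induced subgraph; passing to the whole graph can
      -- only shorten it.
      exact SimpleGraph.edist_map_le (SimpleGraph.Embedding.induce _).toHom ⟨x, hx⟩ y
    have hnear' (s : GadgetCopy n m) (x : CompressedVertex V n m r) (hx : x.Attached s) :
        ∃ y ∈ S, G.edist x y < ρ + 1 :=
      hnear s x (.inr ((mem_borderAdjacent_copyEmbedding hB).2 hx))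
    intro x
    obtain hx | ⟨s, z, rfl⟩ := isOuter_or_eq_copy x
    · obtain ⟨o, k, rfl⟩ | ⟨j, hj⟩ := hx.cases
      · obtain h | h := hdom o k
        · obtain ⟨t, ht⟩ := exists_testBit_pathNumber o
          exact hnear' (.inl t) _ (attached_path_inl.2 ⟨h, ht⟩)
        · exact h
      · obtain ⟨t, ht⟩ := exists_attached_set hj
        exact hnear' _ _ ht
    · exact hnear s _ (.inl ⟨z, rfl⟩)
  · rintro x - y -
    obtain hx | ⟨s, z, rfl⟩ := isOuter_or_eq_copy x
    swap
    · exact hcopy s z y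
    obtain hy | ⟨s, z, rfl⟩ := isOuter_or_eq_copy y
    swap
    · exact (hcopy s z x).imp Eq.symm hsymm
    by_cases heq : ∀ s, x.Attached s ↔ y.Attached s
    swap
    · push Not at heq
      obtain ⟨s, ⟨h1, h2⟩ | ⟨h1, h2⟩⟩ := heq
      · exact .inr (hatt h1 hy h2)
      · exact .inr (hsymm (hatt h2 hx h1))
    -- Equal attachments rule out mixed pairs, as set vertices touch some copy on the set side and
    -- path vertices touch none; between two set vertices they force the same index j.
    obtain ⟨o, k, rfl⟩ | ⟨j, hj⟩ := hx.cases <;> obtain ⟨o', k', rfl⟩ | ⟨j', hj'⟩ := hy.cases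
    · by_cases hne : o ≠ o' ∨ k ≠ k'
      · refine .inr ?_
        obtain hk | hk := le_total k k'
        · exact hpath o k o' k' hk hne heq
        · exact hsymm (hpath o' k' o k hk (hne.imp Ne.symm Ne.symm) fun s => (heq s).symm)
      · push Not at hne
        exact .inl (by rw [hne.1, hne.2])
    · obtain ⟨t, ht⟩ := exists_attached_set hj'
      exact (not_attached_path_inr ((heq _).2 ht)).elim
    · obtain ⟨t, ht⟩ := exists_attached_set hj
      exact (not_attached_path_inr ((heq _).1 ht)).elim
    · have hjj : j = j' := by
        by_contra hne
        obtain ⟨t, ht⟩ := exists_testBit_ne_of_lt_two_pow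
          (lt_of_le_of_lt (show (j : ℕ) + 1 ≤ m by omega) (lt_two_pow_binLen m))
          (lt_of_le_of_lt (show (j' : ℕ) + 1 ≤ m by omega) (lt_two_pow_binLen m))
          (fun h => hne (Fin.ext (by omega)))
        have := heq (.inr t)
        rw [attached_set_iff hj, attached_set_iff hj'] at this
        exact ht (Bool.eq_iff_iff.2 this)
      subst hjj
      rcases hj with rfl | rfl <;> rcases hj' with rfl | rfl
      · exact .inl rfl
      · exact .inr (hset j)
      · exact .inr (hsymm (hset j))
      · exact .inl rfl

/-! ### Distances in the compressed graph -/

theorem compressedGraph_lipschitz {φ : CompressedVertex V n m r → ℕ}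
    (hφ : ∀ v w, CompressedEdge H B I r v w → φ v ≤ φ w + 1 ∧ φ w ≤ φ v + 1)
    (v w : CompressedVertex V n m r) (h : (compressedGraph H B I r).Adj v w) : φ w ≤ φ v + 1 :=
  (edge_of_compressedGraph_adj h).elim (fun h => (hφ _ _ h).2) fun h => (hφ _ _ h).1

/-- A lower bound for the distance from the first vertices of the element paths. -/
def elemPotential : CompressedVertex V n m r → ℕ
  | .elemGadget _ _ => 0
  | .setGadget _ _ => r + 1
  | .elem _ k => k
  | .apex k => k + 1
  | .pos _ => r
  | .neg _ => r + 1

/-- A walk to v̄_j must arrive through the apex path or a copy on the set side, and either route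
costs one step more than the r steps needed to reach the v-vertices. -/
theorem lt_edist_neg (i : Fin n) (k : Fin r) (hk : (k : ℕ) = 0) (j : Fin m) :
    (r : ℕ∞) < (compressedGraph H B I r).edist (neg j) (elem i k) := by
  rw [SimpleGraph.edist_comm]
  have h : ((r + 1 : ℕ) : ℕ∞) ≤ (compressedGraph H B I r).edist (elem i k) (neg j) := by
    refine SimpleGraph.le_edist_of_lipschitz (φ := elemPotential)
      (compressedGraph_lipschitz fun v w h => ?_) (by simp [elemPotential, hk])
    cases h <;> simp only [elemPotential] <;> omega
  exact lt_of_lt_of_le (by exact_mod_cast Nat.lt_succ_self r) h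

theorem edist_elem_le (i : Fin n) (l : ℕ) (hl : l < r) (hr : 0 < r) :
    (compressedGraph H B I r).edist (elem i ⟨l, hl⟩) (elem i ⟨0, hr⟩) ≤ l := by
  induction l with
  | zero => simp
  | succ l ih =>
    have h := SimpleGraph.edist_eq_one_iff_adj.2 (compressedGraph_adj_of_edge
      (H := H) (B := B) (I := I) (.elem_path i ⟨l, by omega⟩ ⟨l + 1, hl⟩ rfl))
    refine SimpleGraph.edist_triangle (v := elem i ⟨l, by omega⟩) |>.trans ?_
    rw [SimpleGraph.edist_comm, h, add_comm]
    push_cast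
    gcongr
    exact ih _

theorem edist_apex_le (l : ℕ) (hl : l < r) (hr : 0 < r) :
    (compressedGraph H B I r).edist (apex ⟨l, hl⟩) (apex ⟨0, hr⟩) ≤ l := by
  induction l with
  | zero => simp
  | succ l ih =>
    have h := SimpleGraph.edist_eq_one_iff_adj.2 (compressedGraph_adj_of_edge
      (H := H) (B := B) (I := I) (.apex_path ⟨l, by omega⟩ ⟨l + 1, hl⟩ rfl))
    refine SimpleGraph.edist_triangle (v := apex ⟨l, by omega⟩) |>.trans ?_
    rw [SimpleGraph.edist_comm, h, add_comm]
    push_cast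
    gcongr
    exact ih _

theorem edist_pos_le (i : Fin n) (k : Fin r) (hk : (k : ℕ) = 0) {j : Fin m}
    (hij : i ∈ I.sets j) : (compressedGraph H B I r).edist (pos j) (elem i k) ≤ r := by
  have hr : 0 < r := k.pos
  obtain rfl : k = ⟨0, hr⟩ := Fin.ext hk
  have h := SimpleGraph.edist_eq_one_iff_adj.2 (compressedGraph_adj_of_edge
    (H := H) (B := B) (I := I) (r := r) (.elem_pos i ⟨r - 1, by omega⟩ j (by simp; omega) hij))
  refine SimpleGraph.edist_triangle (v := elem i ⟨r - 1, by omega⟩) |>.trans ?_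
  rw [SimpleGraph.edist_comm, h]
  refine (add_le_add_right (edist_elem_le i (r - 1) (by omega) hr) 1).trans ?_
  exact_mod_cast (by omega : 1 + (r - 1) ≤ r)

theorem edist_path_copy_le {o : Option (Fin n)} {k : Fin r} {t : Fin (binLen (n + 1))}
    (ht : Nat.testBit (pathNumber o) t = true) {b c : V} (hb : b ∈ B) {d : ℕ}
    (hd : H.edist c b ≤ d) (hk : k + 1 + d ≤ r) :
    (compressedGraph H B I r).edist (path o k) (copy (.inl t) c) ≤ r := by
  have hr : 0 < r := k.pos
  have h1 : (compressedGraph H B I r).edist (path o k) (path o ⟨0, hr⟩) ≤ (k : ℕ) := by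
    cases o
    · exact edist_apex_le k k.2 hr
    · exact edist_elem_le _ k k.2 hr
  have h2 : (compressedGraph H B I r).edist (path o ⟨0, hr⟩) (copy (.inl t) b) = 1 :=
    SimpleGraph.edist_eq_one_iff_adj.2 (compressedGraph_adj_copy.2
      (.inr ⟨attached_path_inl.2 ⟨rfl, ht⟩, hb⟩))
  have h3 : (compressedGraph H B I r).edist (copy (.inl t) b) (copy (.inl t) c) ≤ d := by
    rw [SimpleGraph.edist_comm]
    exact (SimpleGraph.edist_map_le (copyEmbedding H B I r (.inl t)).toHom c b).trans hd
  calc _ ≤ _ := SimpleGraph.edist_triangle (v := path o ⟨0, hr⟩)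
    _ ≤ _ := add_le_add_right (SimpleGraph.edist_triangle (v := copy (.inl t) b)) _
    _ ≤ ((k : ℕ) : ℕ∞) + (1 + d) := add_le_add h1 (add_le_add h2.le h3)
    _ ≤ r := by exact_mod_cast (by omega : (k : ℕ) + (1 + d) ≤ r)

/-- A lower bound for the distance from the vertex `c` of the copy `t₀` when all vertices of `B` are
at distance at least `d` from `c`. -/
noncomputable def copyPotential (H : SimpleGraph V) (c : V) (d : ℕ) (t₀ : Fin (binLen (n + 1))) :
    CompressedVertex V n m r → ℕ
  | .elemGadget t x => if t = t₀ then min (H.dist c x) d else d + 2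
  | .setGadget _ _ => d + 1 + r
  | .elem i k => if Nat.testBit (i + 1) t₀ = true then d + 1 + k else d + 2 + k
  | .apex k => d + 1 + k
  | .pos _ => d + 1 + r
  | .neg _ => d + 1 + r

/-- Leaving the copy costs d + 1 steps. A path not attached to this copy costs at least one further
step, since its start is not among the outer vertices joined to the border. -/
theorem lt_edist_path_copy (hH : H.Connected) {c : V} {d : ℕ} (hc : ∀ b ∈ B, d ≤ H.dist c b)
    {o : Option (Fin n)} {k : Fin r} {t : Fin (binLen (n + 1))}
    (hk : r < d + 1 + k ∨ r < d + 2 + k ∧ Nat.testBit (pathNumber o) t ≠ true) :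
    (r : ℕ∞) < (compressedGraph H B I r).edist (path o k) (copy (.inl t) c) := by
  rw [SimpleGraph.edist_comm]
  have h : ((r + 1 : ℕ) : ℕ∞) ≤
      (compressedGraph H B I r).edist (copy (.inl t) c) (path o k) := by
    refine SimpleGraph.le_edist_of_lipschitz (φ := copyPotential H c d t)
      (compressedGraph_lipschitz fun v w h => ?_) ?_
    · cases h with
      | elemGadget t' x y hxy =>
        have h1 := hH.dist_triangle (u := c) (v := x) (w := y)
        have h2 := hH.dist_triangle (u := c) (v := y) (w := x)
        rw [SimpleGraph.dist_eq_one_iff_adj.2 hxy] at h1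
        rw [SimpleGraph.dist_eq_one_iff_adj.2 hxy.symm] at h2
        simp only [copyPotential]
        split_ifs <;> omega
      | elem_border i k t' b hb hk ht =>
        -- Truncating at d makes the potential exactly d on the border, one below that of the
        -- attached path start.
        have := hc b hb
        simp only [copyPotential]
        by_cases h : t' = t
        · subst h
          simp only [ht, if_true]
          omega
        · split_ifs <;> omega
      | apex_border k t' b hb hk =>
        have := hc b hb
        simp only [copyPotential]
        split_ifs <;> omega
      | _ =>
        simp only [copyPotential]
        first | omega | (split_ifs <;> omega)
    · have h0 : copyPotential H c d t (copy (.inl t) c : CompressedVertex V n m r) = 0 := by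
        simp [copy, copyPotential]
      rw [h0]
      rcases o with _ | i
      · simp only [path, Option.elim_none, copyPotential]
        obtain h | ⟨-, h⟩ := hk
        · omega
        · exact (h (by simp [pathNumber])).elim
      · simp only [path, Option.elim_some, copyPotential]
        simp only [pathNumber, Option.elim_some] at hk
        split_ifs with h
        · obtain h' | ⟨-, h'⟩ := hk
          · omega
          · exact (h' h).elim
        · omega
  exact lt_of_lt_of_le (by exact_mod_cast Nat.lt_succ_self r) h

/-! ### The solution set identifies: layered and local cases -/

theorem exists_hitting_elem_mem_solutionSet {P : Finset (Fin n)} (hP : I.IsHittingSet P)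
    (hr : 0 < r) (C : Set V) (j : Fin m) :
    ∃ i ∈ I.sets j, elem i ⟨0, hr⟩ ∈ (solutionSet C P r : Set (CompressedVertex V n m r)) := by
  obtain ⟨i, hi⟩ := hP j
  rw [Finset.mem_inter] at hi
  exact ⟨i, hi.1, .inr ⟨i, hi.2, _, rfl, rfl⟩⟩

theorem isDistanceIdentifyingSet_solutionSet_of_isLayered [Finite V] (hn : 0 < n)
    {f : IdentifyingFunction.{u}} (hfl : f.IsLayered 1) {ρ : ℕ∞} (hB : B.Nonempty)
    (hgadget : IsGadget f ρ H B C) {P : Finset (Fin n)} (hP : I.IsHittingSet P) :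
    IsDistanceIdentifyingSet f ρ (compressedGraph H B I 1) (solutionSet C P 1) := by
  refine isDistanceIdentifyingSet_of_forall_path hn one_pos hB hgadget
    (fun s c hc => copy_mem_solutionSet s hc) (fun o k => .inl (by omega)) ?_ fun j => ?_
  · intro o k o' k' _ hne heq
    -- With one vertex per path, distinct paths have distinct numbers and hence different
    -- attachments.
    exfalso
    obtain rfl : k = k' := Subsingleton.elim _ _
    have hoo : o ≠ o' := by simpa using hne
    obtain ⟨t, ht⟩ := exists_testBit_ne_of_lt_two_pow (pathNumber_lt o) (pathNumber_lt o')
      (pathNumber_injective.ne hoo)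
    have := heq (.inl t)
    have hk : (k : ℕ) = 0 := by omega
    simp only [attached_path_inl, hk, true_and] at this
    exact ht (Bool.eq_iff_iff.2 this)
  · obtain ⟨i, hi, hS⟩ := exists_hitting_elem_mem_solutionSet hP one_pos C j
    have h1 := edist_pos_le (H := H) (B := B) i ⟨0, one_pos⟩ rfl hi
    have h2 := lt_edist_neg (H := H) (B := B) (I := I) i ⟨0, one_pos⟩ rfl j
    exact ⟨_, hS, hfl _ _ _ _ (by simp) (min_le_of_left_le (by exact_mod_cast h1))
      (h1.trans_lt h2).ne⟩

theorem IsLocalGadget.exists_edist {g : IdentifyingFunction.{u}} {q : ℕ}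
    (hlocal : IsLocalGadget g q H B C) {d : ℕ} (hd : d < q) :
    ∃ c ∈ C, (∃ b ∈ B, H.edist c b ≤ d) ∧ ∀ b ∈ B, d ≤ H.dist c b := by
  obtain ⟨c, hc, h⟩ := hlocal.exists_dist (d + 1) (by simp; omega)
  rw [Nat.add_sub_cancel] at h
  refine ⟨c, hc, ?_, fun b hb => ?_⟩
  -- Strictness against d + 1 extracts a vertex of `B` at distance at most d from the infimum.
  · have hlt : ⨅ b ∈ B, H.edist c b < (d + 1 : ℕ) := by
      rw [h]
      exact_mod_cast Nat.lt_succ_self d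
    simp only [iInf_lt_iff] at hlt
    obtain ⟨b, hb, hlt⟩ := hlt
    exact ⟨b, hb, Order.lt_add_one_iff_of_not_isMax (by simp) |>.1 (by exact_mod_cast hlt)⟩
  · have hle : (d : ℕ∞) ≤ H.edist c b := h ▸ iInf₂_le b hb
    rw [← (hlocal.gadget.connected c b).coe_dist_eq_edist] at hle
    exact_mod_cast hle

theorem IsLocalGadget.border_nonempty {g : IdentifyingFunction.{u}} {q : ℕ}
    (hlocal : IsLocalGadget g q H B C) : B.Nonempty := by
  obtain ⟨_, -, ⟨b, hb, -⟩, -⟩ := hlocal.exists_edist hlocal.pos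
  exact ⟨b, hb⟩

theorem isDistanceIdentifyingSet_solutionSet_of_isLocalGadget [Finite V] (hn : 0 < n)
    {g : IdentifyingFunction.{u}} {q : ℕ} (hlocal : IsLocalGadget g q H B C)
    {P : Finset (Fin n)} (hP : I.IsHittingSet P) :
    IsDistanceIdentifyingSet g q (compressedGraph H B I q) (solutionSet C P q) := by
  have hq : 0 < q := hlocal.pos
  refine isDistanceIdentifyingSet_of_forall_path hn hq hlocal.border_nonempty hlocal.gadget
    (fun s c hc => copy_mem_solutionSet s hc) (fun o k => .inr ?_) ?_ fun j => ?_
  · obtain ⟨c, hc, ⟨b, hb, hcb⟩, -⟩ := hlocal.exists_edist (d := q - 1 - k) (by omega)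
    obtain ⟨t, ht⟩ := exists_testBit_pathNumber o
    exact ⟨_, copy_mem_solutionSet (.inl t) hc, (edist_path_copy_le ht hb hcb (by omega)).trans_lt
      (by exact_mod_cast Nat.lt_succ_self q)⟩
  · intro o k o' k' hk hne _
    -- This choice gives k + 1 + d = q: an attached path's k-th vertex is just within range, whereas
    -- any later path vertex, or the k-th vertex of an unattached path, is out of range.
    obtain ⟨c, hc, ⟨b, hb, hcb⟩, hd⟩ := hlocal.exists_edist (d := q - 1 - k) (by omega)
    have hpne : (path o k : CompressedVertex V n m q) ≠ path o' k' := by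
      rcases o with _ | i <;> rcases o' with _ | i' <;> simp [path] at hne ⊢ <;> tauto
    have near {o : Option (Fin n)} {t : Fin (binLen (n + 1))}
        (ht : Nat.testBit (pathNumber o) t = true) :
        (compressedGraph H B I q).edist (path o k) (copy (.inl t) c) ≤ q :=
      edist_path_copy_le ht hb hcb (by omega)
    obtain hlt | rfl := hk.lt_or_eq
    · obtain ⟨t, ht⟩ := exists_testBit_pathNumber o
      exact ⟨_, copy_mem_solutionSet (.inl t) hc, (hlocal.isLocal _ _ _ _ hpne).1 (.inl ⟨near ht,
        lt_edist_path_copy hlocal.gadget.connected hd (.inl (by omega))⟩)⟩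
    -- At equal height the paths differ, so a copy attached to exactly one of them separates the two
    -- vertices.
    · have hoo : o ≠ o' := by simpa using hne
      obtain ⟨t, ht⟩ := exists_testBit_ne_of_lt_two_pow (pathNumber_lt o) (pathNumber_lt o')
        (pathNumber_injective.ne hoo)
      refine ⟨_, copy_mem_solutionSet (.inl t) hc, (hlocal.isLocal _ _ _ _ hpne).1 ?_⟩
      by_cases h : Nat.testBit (pathNumber o) t = true
      · exact .inl ⟨near h, lt_edist_path_copy hlocal.gadget.connected hd
          (.inr ⟨by omega, fun h' => ht (h.trans h'.symm)⟩)⟩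
      · have h' : Nat.testBit (pathNumber o') t = true := by
          cases h2 : Nat.testBit (pathNumber o') t <;> simp_all
        exact .inr ⟨near h', lt_edist_path_copy hlocal.gadget.connected hd (.inr ⟨by omega, h⟩)⟩
  · obtain ⟨i, hi, hS⟩ := exists_hitting_elem_mem_solutionSet hP hq C j
    exact ⟨_, hS, (hlocal.isLocal _ _ _ _ (by simp)).1
      (.inl ⟨edist_pos_le i _ rfl hi, lt_edist_neg i _ rfl j⟩)⟩

end Forward

/-! ### The equivalence -/

theorem mainTheorem7
    {n m : ℕ} (I : HittingSetInstance n m) (hn : 0 < n)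
    (f : IdentifyingFunction.{u}) (hf : f.IsDistance) (hfl : f.IsLayered 1)
    (r : ℕ∞) (hr : 1 ≤ r)
    {V : Type u} [Finite V] (H : SimpleGraph V) (B C : Set V) (hB : B.Nonempty)
    (hgadget : IsGadget f r H B C)
    (g : IdentifyingFunction.{u}) (hg : g.IsDistance) (q : ℕ)
    {V' : Type u} [Finite V'] (H' : SimpleGraph V') (B' C' : Set V')
    (hlocal : IsLocalGadget g q H' B' C')
    (k : ℕ) (hk : k ≤ n) :
    List.TFAE [
      ∃ P : Finset (Fin n), I.IsHittingSet P ∧ P.card = k,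
      ∃ S : Set (CompressedVertex V n m 1),
        IsDistanceIdentifyingSet f r (compressedGraph H B I 1) S ∧
          S.ncard = k + C.ncard * (binLen (n + 1) + binLen m),
      ∃ S : Set (CompressedVertex V' n m q),
        IsDistanceIdentifyingSet g q (compressedGraph H' B' I q) S ∧
          S.ncard = k + C'.ncard * (binLen (n + 1) + binLen m)] := by
  have h12 : (∃ P : Finset (Fin n), I.IsHittingSet P ∧ P.card = k) →
      ∃ S : Set (CompressedVertex V n m 1),
        IsDistanceIdentifyingSet f r (compressedGraph H B I 1) S ∧
          S.ncard = k + C.ncard * (binLen (n + 1) + binLen m) := by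
    rintro ⟨P, hP, rfl⟩
    exact ⟨_, isDistanceIdentifyingSet_solutionSet_of_isLayered hn hfl hB hgadget hP,
      ncard_solutionSet one_pos C P⟩
  have h13 : (∃ P : Finset (Fin n), I.IsHittingSet P ∧ P.card = k) →
      ∃ S : Set (CompressedVertex V' n m q),
        IsDistanceIdentifyingSet g q (compressedGraph H' B' I q) S ∧
          S.ncard = k + C'.ncard * (binLen (n + 1) + binLen m) := by
    rintro ⟨P, hP, rfl⟩
    exact ⟨_, isDistanceIdentifyingSet_solutionSet_of_isLocalGadget hn hlocal hP,
      ncard_solutionSet hlocal.pos C' P⟩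
  tfae_have 1 → 2 := h12
  tfae_have 1 → 3 := h13
  tfae_have 2 → 1 := fun ⟨_, hS, hcard⟩ =>
    exists_hittingSet_of_isDistanceIdentifyingSet hn one_pos hf hB hgadget hk hS hcard
  tfae_have 3 → 1 := fun ⟨_, hS, hcard⟩ =>
    exists_hittingSet_of_isDistanceIdentifyingSet hn hlocal.pos hg hlocal.border_nonempty
      hlocal.gadget hk hS hcard
  tfae_finish
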